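/- Let $I$ be a set and let $A=(A_{ij})_{i,j\in I}$ be a $\{0,1\}$-matrix with no identically zero row. The unital Exel--Laca algebra $\widetilde{\mathcal O}_A$ is the universal unital C*-algebra generated by partial isometries $\{S_i\}_{i\in I}$ subject to the relations (EL1) $S_i^*S_iS_j^*S_j=S_j^*S_jS_i^*S_i$ for all $i,j\in I$; (EL2) $S_iS_i^*S_jS_j^*=0$ whenever $i\neq j$; (EL3) $S_i^*S_iS_jS_j^*=A_{ij}S_jS_j^*$ for all $i,j\in I$; (EL4) for all finite $X,Y\subseteq I$ such that $A(X,Y,j):=\prod_{x\in X}A_{xj}\prod_{y\in Y}(1-A_{yj})$ is zero for all but finitely many $j\in I$, $$\prod_{x\in X}S_x^*S_x\prod_{y\in Y}(1-S_y^*S_y)=\sum_{j\in I}A(X,Y,j)S_jS_j^*.$$ Let $\mathsf X_A=\{(x_n)\in I^{\mathbb N}: A_{x_nx_{n+1}}=1\text{ for all }n\in\mathbb N\}$, a one-sided subshift over the alphabet $I$. For a one-sided subshift $\mathsf X$ over an alphabet $\mathscr A$, let $\mathcal L_{\mathsf X}$ be its language (the set of finite words, including the empty word $\omega$, that occur in sequences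 of $\mathsf X$), for $\alpha,\beta\in\mathcal L_{\mathsf X}$ put $C(\alpha,\beta)=\{\beta x\in\mathsf X:\alpha x\in\mathsf X\}$, and let $\mathcal U$ be the Boolean algebra of subsets of $\mathsf X$ generated by all the sets $C(\alpha,\beta)$. The unital subshift C*-algebra $\widetilde{\mathcal O}_{\mathsf X}$ is the universal unital C*-algebra generated by projections $\{p_E:E\in\mathcal U\}$ and partial isometries $\{s_a:a\in\mathscr A\}$ subject to the relations (i) $p_{\mathsf X}=1$, $p_{E\cap F}=p_Ep_F$, $p_{E\cup F}=p_E+p_F-p_{E\cap F}$ and $p_\emptyset=0$ for all $E,F\in\mathcal U$; (ii) $s_\beta s_\alpha^*s_\alpha s_\beta^*=p_{C(\alpha,\beta)}$ for all $\alpha,\beta\in\mathcal L_{\mathsf X}$, where $s_\omega:=1$ and $s_\alpha:=s_{\alpha_1}\cdots s_{\alpha_n}$ for $\alpha=\alpha_1\cdots\alpha_n$. Then $\widetilde{\mathcal O}_A$ and $\widetilde{\mathcal O}_{\mathsf X_A}$ are isomorphic as C*-algebras: $\widetilde{\mathcal O}_A\cong\widetilde{\mathcal O}_{\mathsf X_A}$.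 -/

import Mathlib

/-! ### Universal unital C⋆-algebras given by generators and relations -/

/-- The free unital complex `*`-algebra on `G`: noncommutative polynomials in the letters
`g` (left summand) and `g*` (right summand). -/
def FreeStarAlg (G : Type*) : Type _ := FreeAlgebra ℂ (G ⊕ G)

namespace FreeStarAlg

variable {G : Type*}

noncomputable instance : Ring (FreeStarAlg G) := inferInstanceAs (Ring (FreeAlgebra ℂ (G ⊕ G)))

noncomputable instance : Algebra ℂ (FreeStarAlg G) :=
  inferInstanceAs (Algebra ℂ (FreeAlgebra ℂ (G ⊕ G)))

/-- The letters `g` and `g*`. -/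
noncomputable def letter (l : G ⊕ G) : FreeStarAlg G := FreeAlgebra.ι ℂ l

/-- The generator `g`. -/
noncomputable def gen (g : G) : FreeStarAlg G := letter (Sum.inl g)

theorem induction {C : FreeStarAlg G → Prop} (h_scalar : ∀ c : ℂ, C (algebraMap ℂ _ c))
    (h_letter : ∀ l, C (letter l)) (h_mul : ∀ a b, C a → C b → C (a * b))
    (h_add : ∀ a b, C a → C b → C (a + b)) (a : FreeStarAlg G) : C a :=
  FreeAlgebra.induction ℂ (G ⊕ G) h_scalar h_letter h_mul h_add a

/-- The involution as a ring homomorphism to the opposite ring: it conjugates scalars, exchanges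
`g` and `g*`, and reverses products. -/
noncomputable def starHom : FreeStarAlg G →+* (FreeStarAlg G)ᵐᵒᵖ :=
  letI : Algebra ℂ (FreeStarAlg G)ᵐᵒᵖ := Algebra.compHom _ (starRingEnd ℂ)
  (FreeAlgebra.lift ℂ (fun l : G ⊕ G => MulOpposite.op (letter l.swap)) :
    FreeAlgebra ℂ (G ⊕ G) →ₐ[ℂ] (FreeStarAlg G)ᵐᵒᵖ).toRingHom

theorem starHom_letter (l : G ⊕ G) : starHom (letter l) = MulOpposite.op (letter l.swap) :=
  letI : Algebra ℂ (FreeStarAlg G)ᵐᵒᵖ := Algebra.compHom _ (starRingEnd ℂ)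
  FreeAlgebra.lift_ι_apply (R := ℂ) (fun l : G ⊕ G => MulOpposite.op (letter l.swap)) l

theorem starHom_algebraMap (c : ℂ) :
    starHom (algebraMap ℂ (FreeStarAlg G) c)
      = MulOpposite.op (algebraMap ℂ (FreeStarAlg G) (starRingEnd ℂ c)) :=
  letI : Algebra ℂ (FreeStarAlg G)ᵐᵒᵖ := Algebra.compHom _ (starRingEnd ℂ)
  AlgHom.commutes (FreeAlgebra.lift ℂ (fun l : G ⊕ G => MulOpposite.op (letter l.swap)) :
    FreeAlgebra ℂ (G ⊕ G) →ₐ[ℂ] (FreeStarAlg G)ᵐᵒᵖ) c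

noncomputable instance : StarRing (FreeStarAlg G) where
  star a := (starHom a).unop
  star_involutive a := by
    change (starHom (starHom a).unop).unop = a
    induction a using FreeStarAlg.induction with
    | h_scalar c => simp [starHom_algebraMap]
    | h_letter l => simp [starHom_letter]
    | h_mul a b ha hb => simp [ha, hb]
    | h_add a b ha hb => simp [ha, hb]
  star_mul a b := by simp
  star_add a b := by simp

theorem star_letter (l : G ⊕ G) : star (letter l) = letter l.swap :=
  congrArg MulOpposite.unop (starHom_letter l)

theorem star_algebraMap (c : ℂ) :
    star (algebraMap ℂ (FreeStarAlg G) c) = algebraMap ℂ (FreeStarAlg G) (star c) :=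
  congrArg MulOpposite.unop (starHom_algebraMap c)

instance : StarModule ℂ (FreeStarAlg G) where
  star_smul c a := by
    rw [Algebra.smul_def, star_mul, star_algebraMap, Algebra.smul_def, Algebra.commutes]

end FreeStarAlg

/-- A C⋆-seminorm on the free `*`-algebra. -/
structure IsCStarSeminorm {G : Type*} (p : Seminorm ℂ (FreeStarAlg G)) : Prop where
  mul_le : ∀ a b, p (a * b) ≤ p a * p b
  star_mul_self : ∀ a, p (star a * a) = p a ^ 2

namespace IsCStarSeminorm

variable {G : Type*} {p : Seminorm ℂ (FreeStarAlg G)}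

theorem le_star (hp : IsCStarSeminorm p) (a : FreeStarAlg G) : p a ≤ p (star a) := by
  have h : p a ^ 2 ≤ p (star a) * p a := hp.star_mul_self a ▸ hp.mul_le _ _
  have h0 := apply_nonneg p a
  have h1 := apply_nonneg p (star a)
  by_contra! hlt
  nlinarith

theorem map_star (hp : IsCStarSeminorm p) (a : FreeStarAlg G) : p (star a) = p a :=
  le_antisymm (by simpa using hp.le_star (star a)) (hp.le_star a)

theorem map_one_le (hp : IsCStarSeminorm p) : p 1 ≤ 1 := by
  have h := hp.star_mul_self 1
  simp only [star_one, mul_one] at h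
  by_contra! hlt
  nlinarith

theorem congr_of_sub {a b : FreeStarAlg G} (h : p (a - b) = 0) : p a = p b := by
  have h1 := abs_sub_map_le_sub p a b
  rw [h] at h1
  have := abs_nonpos_iff.mp h1
  linarith

theorem zero : IsCStarSeminorm (0 : Seminorm ℂ (FreeStarAlg G)) :=
  ⟨fun _ _ => by simp, fun _ => by simp⟩

/-- A partial isometry has norm at most one. -/
theorem le_one_of_partialIsometry (hp : IsCStarSeminorm p) {a : FreeStarAlg G}
    (h : p (a * star a * a - a) = 0) : p a ≤ 1 := by
  have h0 := apply_nonneg p a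
  have h1 : p (star a * a * (star a * a) - star a * a) = 0 := by
    refine le_antisymm ?_ (apply_nonneg _ _)
    have : star a * a * (star a * a) - star a * a = star a * (a * star a * a - a) := by
      noncomm_ring
    rw [this]
    refine (hp.mul_le _ _).trans ?_
    rw [h, mul_zero]
  have h2 := congr_of_sub h1
  have h3 := hp.star_mul_self (star a * a)
  rw [star_mul, star_star, h2, hp.star_mul_self] at h3
  by_contra! hlt
  nlinarith [mul_pos (show (0:ℝ) < p a ^ 2 by positivity) (show (0:ℝ) < p a ^ 2 - 1 by nlinarith)]

/-- A projection has norm at most one. -/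
theorem le_one_of_projection (hp : IsCStarSeminorm p) {a : FreeStarAlg G}
    (h : p (a * a - a) = 0) (hs : p (star a - a) = 0) : p a ≤ 1 := by
  have h0 := apply_nonneg p a
  have h1 : p (star a * a - a * a) = 0 := by
    refine le_antisymm ?_ (apply_nonneg _ _)
    rw [← sub_mul]
    refine (hp.mul_le _ _).trans ?_
    rw [hs, zero_mul]
  have h2 := congr_of_sub h1
  rw [hp.star_mul_self, congr_of_sub h] at h2
  by_contra! hlt
  nlinarith

end IsCStarSeminorm

/-- The continuous extension of the involution of a seminormed `*`-ring to its completion. -/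
@[reducible]
noncomputable def completionStarRing (R : Type*) [SeminormedRing R] [StarRing R]
    [NormedStarGroup R] : StarRing (UniformSpace.Completion R) :=
  have hu : UniformContinuous (star : R → R) := (starNormedAddGroupHom (E := R)).uniformContinuous
  have hc := UniformSpace.Completion.continuous_map (f := (star : R → R))
  { star := UniformSpace.Completion.map (star : R → R)
    star_involutive := fun x => by
      refine UniformSpace.Completion.induction_on x
        (isClosed_eq (hc.comp hc) continuous_id) fun a => ?_
      rw [UniformSpace.Completion.map_coe hu, UniformSpace.Completion.map_coe hu, star_star]
    star_mul := fun x y => by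
      refine UniformSpace.Completion.induction_on₂ x y
        (isClosed_eq (hc.comp (continuous_fst.mul continuous_snd))
          ((hc.comp continuous_snd).mul (hc.comp continuous_fst))) fun a b => ?_
      rw [← UniformSpace.Completion.coe_mul, UniformSpace.Completion.map_coe hu,
        UniformSpace.Completion.map_coe hu, UniformSpace.Completion.map_coe hu, star_mul,
        UniformSpace.Completion.coe_mul]
    star_add := fun x y => by
      refine UniformSpace.Completion.induction_on₂ x y
        (isClosed_eq (hc.comp (continuous_fst.add continuous_snd))
          ((hc.comp continuous_fst).add (hc.comp continuous_snd))) fun a b => ?_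
      rw [← UniformSpace.Completion.coe_add, UniformSpace.Completion.map_coe hu,
        UniformSpace.Completion.map_coe hu, UniformSpace.Completion.map_coe hu, star_add,
        UniformSpace.Completion.coe_add] }

/-- Generators `G` subject to relations `a = b` between `*`-polynomials in the generators, such that
every generator is uniformly bounded in all the C⋆-seminorms that respect the relations (which is
what makes the universal C⋆-algebra exist). -/
structure CStarPresentation (G : Type*) where
  rel : FreeStarAlg G → FreeStarAlg G → Prop
  bounded : ∀ g : G, ∃ c : ℝ, ∀ p : Seminorm ℂ (FreeStarAlg G), IsCStarSeminorm p →
    (∀ a b, rel a b → p (a - b) = 0) → p (FreeStarAlg.gen g) ≤ c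

namespace CStarPresentation

variable {G : Type*} (P : CStarPresentation G)

/-- The C⋆-seminorms that respect the relations. -/
def Admissible (p : Seminorm ℂ (FreeStarAlg G)) : Prop :=
  IsCStarSeminorm p ∧ ∀ a b, P.rel a b → p (a - b) = 0

instance : Nonempty {p // P.Admissible p} :=
  ⟨⟨0, IsCStarSeminorm.zero, fun _ _ _ => by simp⟩⟩

theorem exists_bound (a : FreeStarAlg G) : ∃ c : ℝ, ∀ p, P.Admissible p → p a ≤ c := by
  induction a using FreeStarAlg.induction with
  | h_scalar z =>
    refine ⟨‖z‖, fun p hp => ?_⟩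
    rw [Algebra.algebraMap_eq_smul_one, map_smul_eq_mul]
    exact mul_le_of_le_one_right (norm_nonneg _) hp.1.map_one_le
  | h_letter l =>
    rcases l with g | g
    · obtain ⟨c, hc⟩ := P.bounded g
      exact ⟨c, fun p hp => hc p hp.1 hp.2⟩
    · obtain ⟨c, hc⟩ := P.bounded g
      refine ⟨c, fun p hp => ?_⟩
      have h := hc p hp.1 hp.2
      rw [← hp.1.map_star] at h
      simpa [FreeStarAlg.gen, FreeStarAlg.star_letter] using h
  | h_mul a b ha hb =>
    obtain ⟨c, hc⟩ := ha
    obtain ⟨d, hd⟩ := hb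
    refine ⟨c * d, fun p hp => (hp.1.mul_le a b).trans ?_⟩
    exact mul_le_mul (hc p hp) (hd p hp) (apply_nonneg _ _)
      ((apply_nonneg _ _).trans (hc p hp))
  | h_add a b ha hb =>
    obtain ⟨c, hc⟩ := ha
    obtain ⟨d, hd⟩ := hb
    exact ⟨c + d, fun p hp => (map_add_le_add p a b).trans (add_le_add (hc p hp) (hd p hp))⟩

/-- The largest C⋆-seminorm that respects the relations. -/
noncomputable def univNorm (a : FreeStarAlg G) : ℝ := ⨆ p : {p // P.Admissible p}, p.1 a

theorem bddAbove (a : FreeStarAlg G) :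
    BddAbove (Set.range fun p : {p // P.Admissible p} => p.1 a) := by
  obtain ⟨c, hc⟩ := P.exists_bound a
  exact ⟨c, by rintro _ ⟨p, rfl⟩; exact hc p.1 p.2⟩

theorem le_univNorm {p : Seminorm ℂ (FreeStarAlg G)} (hp : P.Admissible p) (a : FreeStarAlg G) :
    p a ≤ P.univNorm a :=
  le_ciSup (P.bddAbove a) (⟨p, hp⟩ : {p // P.Admissible p})

theorem univNorm_le {a : FreeStarAlg G} {c : ℝ} (h : ∀ p, P.Admissible p → p a ≤ c) :
    P.univNorm a ≤ c :=
  ciSup_le fun p => h p.1 p.2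

theorem univNorm_nonneg (a : FreeStarAlg G) : 0 ≤ P.univNorm a :=
  Real.iSup_nonneg fun p => apply_nonneg p.1 a

/-- The free `*`-algebra, seminormed by the largest C⋆-seminorm that respects the relations. -/
def Pre (_P : CStarPresentation G) : Type _ := FreeStarAlg G

noncomputable instance : Ring P.Pre := inferInstanceAs (Ring (FreeStarAlg G))

noncomputable instance : Algebra ℂ P.Pre := inferInstanceAs (Algebra ℂ (FreeStarAlg G))

noncomputable instance : StarRing P.Pre := inferInstanceAs (StarRing (FreeStarAlg G))

instance : StarModule ℂ P.Pre := inferInstanceAs (StarModule ℂ (FreeStarAlg G))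

/-- `univNorm` as a ring seminorm. -/
noncomputable def univRingSeminorm : RingSeminorm P.Pre where
  toFun a := P.univNorm a
  map_zero' := le_antisymm (P.univNorm_le fun q _ => (map_zero q).le) (P.univNorm_nonneg _)
  add_le' _ _ := P.univNorm_le fun p hp => (map_add_le_add p _ _).trans
    (add_le_add (P.le_univNorm hp _) (P.le_univNorm hp _))
  neg' _ := congrArg iSup (funext fun p => map_neg_eq_map p.1 _)
  mul_le' _ _ := P.univNorm_le fun p hp => (hp.1.mul_le _ _).trans
    (mul_le_mul (P.le_univNorm hp _) (P.le_univNorm hp _) (apply_nonneg _ _)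
      (P.univNorm_nonneg _))

noncomputable instance : SeminormedRing P.Pre := P.univRingSeminorm.toSeminormedRing

theorem norm_def (a : P.Pre) : ‖a‖ = P.univNorm a := rfl

noncomputable instance : NormedAlgebra ℂ P.Pre where
  norm_smul_le c a := P.univNorm_le fun p hp => by
    have h : p (c • (a : FreeStarAlg G)) = ‖c‖ * p a := map_smul_eq_mul p c _
    exact h.le.trans (mul_le_mul_of_nonneg_left (P.le_univNorm hp a) (norm_nonneg c))

theorem norm_star_pre (a : P.Pre) : ‖star a‖ = ‖a‖ :=
  congrArg iSup (funext fun p => p.2.1.map_star _)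

theorem norm_mul_self_le_pre (a : P.Pre) : ‖a‖ * ‖a‖ ≤ ‖star a * a‖ := by
  have h : ‖a‖ ≤ √‖star a * a‖ := P.univNorm_le fun p hp => by
    refine Real.le_sqrt_of_sq_le ?_
    have h2 := hp.1.star_mul_self (a : FreeStarAlg G)
    exact h2.ge.trans (P.le_univNorm hp _)
  calc ‖a‖ * ‖a‖ ≤ √‖star a * a‖ * √‖star a * a‖ :=
        mul_self_le_mul_self (norm_nonneg _) h
    _ = ‖star a * a‖ := Real.mul_self_sqrt (norm_nonneg _)

instance : NormedStarGroup P.Pre := ⟨fun a => (P.norm_star_pre a).le⟩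

/-- The universal unital C⋆-algebra of a presentation: the Hausdorff completion of the free
`*`-algebra in the largest C⋆-seminorm that respects the relations. -/
def UniversalAlg : Type _ := UniformSpace.Completion P.Pre

open UniformSpace in
noncomputable instance : NormedRing P.UniversalAlg :=
  inferInstanceAs (NormedRing (Completion P.Pre))

instance : CompleteSpace P.UniversalAlg :=
  inferInstanceAs (CompleteSpace (UniformSpace.Completion P.Pre))

noncomputable instance : NormedAlgebra ℂ P.UniversalAlg where
  __ := (inferInstanceAs (Algebra ℂ (UniformSpace.Completion P.Pre)) :
    Algebra ℂ P.UniversalAlg)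
  norm_smul_le := norm_smul_le (α := ℂ) (β := UniformSpace.Completion P.Pre)

/-- The canonical map from the free `*`-algebra. -/
noncomputable def of (a : FreeStarAlg G) : P.UniversalAlg :=
  ((show P.Pre from a : P.Pre) : UniformSpace.Completion P.Pre)

instance : T2Space P.UniversalAlg :=
  inferInstanceAs (T2Space (UniformSpace.Completion P.Pre))

noncomputable instance : StarRing P.UniversalAlg := completionStarRing P.Pre

theorem star_of (a : FreeStarAlg G) : star (P.of a) = P.of (star a) :=
  UniformSpace.Completion.map_coe (starNormedAddGroupHom (E := P.Pre)).uniformContinuous _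

theorem continuous_star : Continuous (star : P.UniversalAlg → P.UniversalAlg) :=
  UniformSpace.Completion.continuous_map (f := (star : P.Pre → P.Pre))

theorem of_mul (a b : FreeStarAlg G) : P.of (a * b) = P.of a * P.of b :=
  UniformSpace.Completion.coe_mul (α := P.Pre) a b

theorem of_smul (c : ℂ) (a : FreeStarAlg G) : P.of (c • a) = c • P.of a :=
  UniformSpace.Completion.coe_smul (X := P.Pre) c a

theorem norm_of (a : FreeStarAlg G) : ‖P.of a‖ = P.univNorm a :=
  UniformSpace.Completion.norm_coe (E := P.Pre) a

theorem of_induction {C : P.UniversalAlg → Prop} (hc : IsClosed {x | C x})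
    (h : ∀ a, C (P.of a)) (x : P.UniversalAlg) : C x :=
  UniformSpace.Completion.induction_on (α := P.Pre) x hc h

instance : StarModule ℂ P.UniversalAlg where
  star_smul c x := by
    induction x using P.of_induction with
    | hc =>
      exact isClosed_eq (P.continuous_star.comp (continuous_const_smul c))
        (P.continuous_star.const_smul (star c))
    | h a => rw [← P.of_smul, P.star_of, P.star_of, star_smul, P.of_smul]

instance : CStarRing P.UniversalAlg where
  norm_mul_self_le x := by
    induction x using P.of_induction with
    | hc =>
      exact isClosed_le (continuous_norm.mul continuous_norm)
        ((P.continuous_star.mul continuous_id).norm)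
    | h a =>
      rw [P.star_of, ← P.of_mul, P.norm_of, P.norm_of]
      exact P.norm_mul_self_le_pre a

noncomputable instance : CStarAlgebra P.UniversalAlg where

end CStarPresentation

/-! ### One-sided subshifts over arbitrary alphabets -/

/-- A one-sided subshift: the sequences in which no word (block of consecutive letters) belongs to
some set `F` of forbidden words. -/
structure Subshift (𝒜 : Type*) where
  carrier : Set (Stream' 𝒜)
  exists_forbidden : ∃ F : Set (List 𝒜),
    carrier = {x | ∀ k n : ℕ, (x.drop k).take n ∉ F}

namespace Subshift

variable {𝒜 : Type*} (X : Subshift 𝒜)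

/-- The language of `X`: the finite words that occur in the sequences of `X`. -/
def language : Set (List 𝒜) := {w | ∃ x ∈ X.carrier, x.take w.length = w}

/-- `C(α, β) = {βx ∈ X : αx ∈ X}`. -/
def C (α β : List 𝒜) : Set X.carrier :=
  {y | ∃ x : Stream' 𝒜, (y : Stream' 𝒜) = β ++ₛ x ∧ α ++ₛ x ∈ X.carrier}

/-- The Boolean algebra of subsets of `X` generated by the sets `C(α, β)`. -/
def U : BooleanSubalgebra (Set X.carrier) :=
  BooleanSubalgebra.closure {S | ∃ α ∈ X.language, ∃ β ∈ X.language, S = X.C α β}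

theorem C_mem_U {α β : List 𝒜} (hα : α ∈ X.language) (hβ : β ∈ X.language) : X.C α β ∈ X.U :=
  BooleanSubalgebra.subset_closure ⟨α, hα, β, hβ, rfl⟩

/-- The generator `s_a`. -/
noncomputable def s (a : 𝒜) : FreeStarAlg (𝒜 ⊕ X.U) := FreeStarAlg.gen (Sum.inl a)

/-- The generator `p_A`, for `A` in the Boolean algebra of `X`. -/
noncomputable def p (A : X.U) : FreeStarAlg (𝒜 ⊕ X.U) := FreeStarAlg.gen (Sum.inr A)

/-- `s_α = s_{α₁} ⋯ s_{αₙ}`, and `1` for the empty word. -/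
noncomputable def sWord (α : List 𝒜) : FreeStarAlg (𝒜 ⊕ X.U) := (α.map X.s).prod

/-- The relations of the unital subshift C⋆-algebra. -/
inductive Rel : FreeStarAlg (𝒜 ⊕ X.U) → FreeStarAlg (𝒜 ⊕ X.U) → Prop
  | s_partialIsometry (a : 𝒜) : Rel (X.s a * star (X.s a) * X.s a) (X.s a)
  | p_idem (A : X.U) : Rel (X.p A * X.p A) (X.p A)
  | p_star (A : X.U) : Rel (star (X.p A)) (X.p A)
  | p_univ : Rel (X.p ⊤) 1
  | p_inter (A B : X.U) : Rel (X.p (A ⊓ B)) (X.p A * X.p B)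
  | p_union (A B : X.U) : Rel (X.p (A ⊔ B)) (X.p A + X.p B - X.p (A ⊓ B))
  | p_empty : Rel (X.p ⊥) 0
  | s_word (α β : List 𝒜) (hα : α ∈ X.language) (hβ : β ∈ X.language) :
      Rel (X.sWord β * star (X.sWord α) * X.sWord α * star (X.sWord β))
        (X.p ⟨X.C α β, X.C_mem_U hα hβ⟩)

/-- Generators and relations of the unital subshift C⋆-algebra. -/
noncomputable def presentation : CStarPresentation (𝒜 ⊕ X.U) where
  rel := X.Rel
  bounded := by
    rintro (a | A)
    · exact ⟨1, fun q hq h => hq.le_one_of_partialIsometry (h _ _ (Rel.s_partialIsometry a))⟩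
    · exact ⟨1, fun q hq h => hq.le_one_of_projection (h _ _ (Rel.p_idem A))
        (h _ _ (Rel.p_star A))⟩

/-- The unital subshift C⋆-algebra of `X`. -/
abbrev UnitalCStarAlg : Type _ := X.presentation.UniversalAlg

end Subshift

/-! ### Unital Exel–Laca algebras -/

namespace ExelLaca

variable {I : Type*} (A : Matrix I I ℤ)

/-- The Markov subshift of `A`. -/
def markovSubshift : Subshift I where
  carrier := {x | ∀ n : ℕ, A (x.get n) (x.get (n + 1)) = 1}
  exists_forbidden := by
    refine ⟨{w | ∃ i j, w = [i, j] ∧ A i j ≠ 1}, ?_⟩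
    ext x
    constructor
    · rintro hx k n ⟨i, j, hw, hij⟩
      have hn : n = 2 := by simpa using congrArg List.length hw
      subst hn
      have h := hx k
      simp only [Stream'.take, List.cons.injEq] at hw
      apply hij
      rw [← hw.1, ← hw.2.1]
      simpa [Stream'.head, Stream'.tail, Stream'.get, Stream'.drop, Nat.add_comm] using h
    · intro hx n
      by_contra h
      refine hx n 2 ⟨x.get n, x.get (n + 1), ?_, h⟩
      simp [Stream'.take, Stream'.head, Stream'.tail, Stream'.get, Stream'.drop, Nat.add_comm]

/-- `A(X, Y, j) = ∏_{x ∈ X} A_{xj} ∏_{y ∈ Y} (1 - A_{yj})`. -/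
def coeff (X Y : Finset I) (j : I) : ℤ := (∏ x ∈ X, A x j) * ∏ y ∈ Y, (1 - A y j)

/-- The generator `S_i`. -/
noncomputable def S (i : I) : FreeStarAlg I := FreeStarAlg.gen i

/-- The relations of the unital Exel–Laca algebra. In `el4` the two products are taken in the order
of an enumeration of `X` and of `Y`, which is immaterial since the factors commute by `el1`. -/
inductive Rel : FreeStarAlg I → FreeStarAlg I → Prop
  | partialIsometry (i : I) : Rel (S i * star (S i) * S i) (S i)
  | el1 (i j : I) :
      Rel (star (S i) * S i * (star (S j) * S j)) (star (S j) * S j * (star (S i) * S i))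
  | el2 (i j : I) (hij : i ≠ j) : Rel (S i * star (S i) * (S j * star (S j))) 0
  | el3 (i j : I) :
      Rel (star (S i) * S i * (S j * star (S j))) (A i j • (S j * star (S j)))
  | el4 (X Y : Finset I) (h : {j | coeff A X Y j ≠ 0}.Finite) :
      Rel ((X.toList.map fun x => star (S x) * S x).prod
          * (Y.toList.map fun y => 1 - star (S y) * S y).prod)
        (∑ j ∈ h.toFinset, coeff A X Y j • (S j * star (S j)))

/-- Generators and relations of the unital Exel–Laca algebra. -/
noncomputable def presentation : CStarPresentation I where
  rel := Rel A
  bounded i :=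
    ⟨1, fun _ hq h => hq.le_one_of_partialIsometry (h _ _ (Rel.partialIsometry i))⟩

/-- The unital Exel–Laca algebra of `A`. -/
abbrev UnitalCStarAlg : Type _ := (presentation A).UniversalAlg

end ExelLaca

/-! The isomorphism matches `S_i` with `s_i`; by the universal property each direction amounts to
checking relations.

From Exel–Laca to subshift, relation (ii) makes `s_i^* s_i` and `s_i s_i^*` the projections of the
followers of `i` and of the cylinder of `i`. Since `p` respects Boolean operations, (EL1)–(EL4)
become identities between sets of paths (`isFamily_iso`).

In the other direction a projection must be built for every set in `U`. The relation `Graph` pairs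
sets with elements: it starts from followers and initial projections and is closed under Boolean
operations and under `(E, q) ↦ (bE, S_b q S_b^*)`. It reaches every `C(α, β)`, hence all of `U`. The
crux is that it is single-valued (`Graph.unique`), which reduces to: an element `q` paired with `∅`
is zero. Modulo finitely many final projections, a pair is decided by each minterm over a large
enough finite index set: the minterm lies in it or misses it (`Graph.exists_finite_determining`).
For `∅`, either `q` kills the minterm there, or no path outside a finite set `F` of first letters
meets the minterm; as every letter starts a path, (EL4) then makes the minterm vanish off `F`. So
`q` is carried by finitely many final projections. Each corner `S_j^* q S_j` is again paired with
`∅` at smaller depth, and induction on depth gives `q = 0`.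

The two homomorphisms are mutually inverse on generators, because relation (ii) expresses every
`p_{C(α, β)}` through the `s_i`. -/

namespace FreeStarAlg

/-! ### Homomorphisms out of the free `*`-algebra. -/

variable {G B : Type*} [Ring B] [StarRing B] [Algebra ℂ B] [StarModule ℂ B]

/-- The unital `*`-homomorphism out of the free `*`-algebra determined by the images of the
generators. -/
noncomputable def lift (f : G → B) : FreeStarAlg G →⋆ₐ[ℂ] B :=
  let φ : FreeStarAlg G →ₐ[ℂ] B := FreeAlgebra.lift ℂ (Sum.elim f fun g => star (f g))
  { φ with
    map_star' := fun a => by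
      have hφ : ∀ l, φ (letter l) = Sum.elim f (fun g => star (f g)) l :=
        fun l => FreeAlgebra.lift_ι_apply _ l
      change φ (star a) = star (φ a)
      induction a using FreeStarAlg.induction with
      | h_scalar c => rw [star_algebraMap, AlgHom.commutes, AlgHom.commutes, algebraMap_star_comm]
      | h_letter l => rcases l with g | g <;> simp [star_letter, hφ]
      | h_mul a b ha hb => simp [ha, hb]
      | h_add a b ha hb => simp [ha, hb] }

@[simp]
theorem lift_gen (f : G → B) (g : G) : lift f (gen g) = f g :=
  FreeAlgebra.lift_ι_apply (R := ℂ) (Sum.elim f fun g => star (f g)) (Sum.inl g)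

/-- A `*`-homomorphism into a C⋆-algebra induces a C⋆-seminorm. -/
noncomputable def normComp {B : Type*} [CStarAlgebra B] (φ : FreeStarAlg G →⋆ₐ[ℂ] B) :
    Seminorm ℂ (FreeStarAlg G) :=
  (normSeminorm ℂ B).comp (φ : FreeStarAlg G →ₐ[ℂ] B).toLinearMap

theorem normComp_apply {B : Type*} [CStarAlgebra B] (φ : FreeStarAlg G →⋆ₐ[ℂ] B)
    (a : FreeStarAlg G) : normComp φ a = ‖φ a‖ := rfl

theorem isCStarSeminorm_normComp {B : Type*} [CStarAlgebra B] (φ : FreeStarAlg G →⋆ₐ[ℂ] B) :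
    IsCStarSeminorm (normComp φ) where
  mul_le a b := by simpa [normComp_apply] using norm_mul_le (φ a) (φ b)
  star_mul_self a := by
    simp only [normComp_apply, map_mul, map_star, CStarRing.norm_star_mul_self, sq]

end FreeStarAlg

/-! ### The universal property of a presented C⋆-algebra. -/

namespace CStarPresentation

open FreeStarAlg

variable {G : Type*} (P : CStarPresentation G) {B : Type*} [CStarAlgebra B]

/-- The canonical map from the free `*`-algebra, as a `*`-homomorphism. -/
noncomputable def ofHom : FreeStarAlg G →⋆ₐ[ℂ] P.UniversalAlg where
  toFun := P.of
  map_one' := UniformSpace.Completion.coe_one P.Pre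
  map_mul' := P.of_mul
  map_zero' := UniformSpace.Completion.coe_zero (α := P.Pre)
  map_add' := UniformSpace.Completion.coe_add (α := P.Pre)
  commutes' c := by
    rw [Algebra.algebraMap_eq_smul_one, P.of_smul, Algebra.algebraMap_eq_smul_one]
    rfl
  map_star' a := (P.star_of a).symm

theorem ofHom_apply (a : FreeStarAlg G) : P.ofHom a = P.of a := rfl

theorem ofHom_eq_of_rel {a b : FreeStarAlg G} (h : P.rel a b) : P.ofHom a = P.ofHom b := by
  rw [← sub_eq_zero, ← map_sub, ← norm_eq_zero, ofHom_apply, P.norm_of]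
  exact le_antisymm (P.univNorm_le fun p hp => (hp.2 _ _ h).le) (P.univNorm_nonneg _)

variable {P}

/-- The norm pulled back along `φ` is an admissible C⋆-seminorm, so the largest one dominates it.
This contractivity is what lets `φ` extend to the completion. -/
theorem norm_le_norm_of {φ : FreeStarAlg G →⋆ₐ[ℂ] B} (h : ∀ a b, P.rel a b → φ a = φ b)
    (a : FreeStarAlg G) : ‖φ a‖ ≤ ‖P.of a‖ := by
  rw [P.norm_of]
  refine P.le_univNorm (p := normComp φ) ⟨isCStarSeminorm_normComp φ, fun a b hab => ?_⟩ a
  rw [normComp_apply, map_sub, h a b hab, sub_self, norm_zero]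

theorem exists_hom (φ : FreeStarAlg G →⋆ₐ[ℂ] B) (h : ∀ a b, P.rel a b → φ a = φ b) :
    ∃ Φ : P.UniversalAlg →⋆ₐ[ℂ] B, ∀ a, Φ (P.of a) = φ a := by
  let φ' : P.Pre →+* B := (φ : FreeStarAlg G →ₐ[ℂ] B).toRingHom
  have hφ' : Continuous φ' :=
    AddMonoidHomClass.continuous_of_bound φ' 1 fun a => by
      rw [one_mul]
      exact (norm_le_norm_of h a).trans_eq (P.norm_of a)
  let Φ : P.UniversalAlg →+* B := UniformSpace.Completion.extensionHom φ' hφ'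
  have hΦ : ∀ a, Φ (P.of a) = φ a := UniformSpace.Completion.extensionHom_coe φ' hφ'
  have hc : Continuous Φ := UniformSpace.Completion.continuous_extension
  refine ⟨{ Φ with
    commutes' := fun c => ?_
    map_star' := fun x => ?_ }, hΦ⟩
  · change Φ (algebraMap ℂ _ c) = _
    rw [← AlgHomClass.commutes P.ofHom, ofHom_apply, hΦ, AlgHomClass.commutes]
  · change Φ (star x) = star (Φ x)
    induction x using P.of_induction with
    | hc => exact isClosed_eq (hc.comp P.continuous_star) hc.star
    | h a => rw [P.star_of, hΦ, hΦ, map_star]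

/-- The universal property: a family of elements of a C⋆-algebra that satisfies the relations
is the image of the generators under a `*`-homomorphism. -/
noncomputable def liftHom (f : G → B) (h : ∀ a b, P.rel a b → lift f a = lift f b) :
    P.UniversalAlg →⋆ₐ[ℂ] B := (exists_hom (lift f) h).choose

theorem liftHom_ofHom (f : G → B) (h : ∀ a b, P.rel a b → lift f a = lift f b)
    (a : FreeStarAlg G) : liftHom f h (P.ofHom a) = lift f a :=
  (exists_hom (lift f) h).choose_spec a

theorem liftHom_gen (f : G → B) (h : ∀ a b, P.rel a b → lift f a = lift f b) (g : G) :
    liftHom f h (P.ofHom (gen g)) = f g := by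
  rw [liftHom_ofHom, lift_gen]

/-- The generators and their adjoints generate a dense subalgebra, and `*`-homomorphisms between
C⋆-algebras are contractive, hence continuous. -/
theorem hom_ext {Φ Ψ : P.UniversalAlg →⋆ₐ[ℂ] B}
    (h : ∀ g, Φ (P.ofHom (gen g)) = Ψ (P.ofHom (gen g))) : Φ = Ψ := by
  have key : ∀ a, Φ (P.ofHom a) = Ψ (P.ofHom a) := by
    intro a
    induction a using FreeStarAlg.induction with
    | h_scalar c => rw [AlgHomClass.commutes P.ofHom, AlgHomClass.commutes, AlgHomClass.commutes]
    | h_letter l =>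
      rcases l with g | g
      · exact h g
      · have : (letter (Sum.inr g) : FreeStarAlg G) = star (gen g) := by
          simp [gen, star_letter]
        rw [this, map_star, map_star, map_star, h]
    | h_mul a b ha hb => simp [ha, hb]
    | h_add a b ha hb => simp [ha, hb]
  ext x
  induction x using P.of_induction with
  | hc =>
    have hc : ∀ Θ : P.UniversalAlg →⋆ₐ[ℂ] B, Continuous Θ := fun Θ =>
      AddMonoidHomClass.continuous_of_bound Θ 1 fun x => by
        rw [one_mul]
        exact NonUnitalStarAlgHom.norm_apply_le Θ x
    exact isClosed_eq (hc Φ) (hc Ψ)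
  | h a => exact key a

end CStarPresentation

/-! ### Algebra of Exel–Laca families in a `*`-ring. -/

namespace ExelLaca

variable {I R : Type*} [Ring R] [StarRing R] {A : Matrix I I ℤ} {S : I → R}

/-- The initial projection `S_i^* S_i`. -/
def initialProj (S : I → R) (i : I) : R := star (S i) * S i

/-- The final projection `S_i S_i^*`. -/
def finalProj (S : I → R) (i : I) : R := S i * star (S i)

/-- The product `∏_{x ∈ X} S_x^* S_x ∏_{y ∈ Y} (1 - S_y^* S_y)`. -/
noncomputable def minterm (S : I → R) (X Y : Finset I) : R :=
  (X.toList.map (initialProj S)).prod * (Y.toList.map fun y => 1 - initialProj S y).prod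

/-- The complement `1 - ∑_{j ∈ F} S_j S_j^*` of finitely many final projections. -/
def finalCompl (S : I → R) (F : Finset I) : R := 1 - ∑ j ∈ F, finalProj S j

/-- A family of elements of a `*`-ring that satisfies the relations of the unital Exel–Laca
algebra. -/
structure IsFamily (A : Matrix I I ℤ) (S : I → R) : Prop where
  partialIsometry : ∀ i, S i * star (S i) * S i = S i
  el1 : ∀ i j, initialProj S i * initialProj S j = initialProj S j * initialProj S i
  el2 : ∀ i j, i ≠ j → finalProj S i * finalProj S j = 0
  el3 : ∀ i j, initialProj S i * finalProj S j = A i j • finalProj S j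
  el4 : ∀ X Y (h : {j | coeff A X Y j ≠ 0}.Finite),
    minterm S X Y = ∑ j ∈ h.toFinset, coeff A X Y j • finalProj S j

theorem star_initialProj (i : I) : star (initialProj S i) = initialProj S i := by
  simp [initialProj]

theorem star_finalProj (i : I) : star (finalProj S i) = finalProj S i := by
  simp [finalProj]

theorem commute_minterm {q : R} (hq : ∀ a, Commute q (initialProj S a)) (X Y : Finset I) :
    Commute q (minterm S X Y) := by
  refine (Commute.list_prod_right _ _ ?_).mul_right (Commute.list_prod_right _ _ ?_)
  · simp only [List.mem_map]
    rintro _ ⟨a, -, rfl⟩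
    exact hq a
  · simp only [List.mem_map]
    rintro _ ⟨a, -, rfl⟩
    exact (Commute.one_right _).sub_right (hq a)

namespace IsFamily

variable (hS : IsFamily A S)
include hS

theorem mul_initialProj (i : I) : S i * initialProj S i = S i := by
  rw [initialProj, ← mul_assoc, hS.partialIsometry]

theorem initialProj_mul_star (i : I) : initialProj S i * star (S i) = star (S i) := by
  simpa [star_initialProj] using congrArg star (hS.mul_initialProj i)

theorem finalProj_mul (i : I) : finalProj S i * S i = S i := hS.partialIsometry i

theorem star_mul_finalProj (i : I) : star (S i) * finalProj S i = star (S i) := by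
  simpa [star_finalProj] using congrArg star (hS.finalProj_mul i)

theorem initialProj_idem (i : I) : initialProj S i * initialProj S i = initialProj S i := by
  conv_lhs => rw [initialProj, mul_assoc, ← initialProj, hS.mul_initialProj]
  rfl

theorem finalProj_idem (i : I) : finalProj S i * finalProj S i = finalProj S i := by
  conv_lhs => rw [finalProj, mul_assoc, ← finalProj, hS.star_mul_finalProj]
  rfl

theorem initialProj_mul (i j : I) : initialProj S i * S j = A i j • S j := by
  rw [← hS.finalProj_mul j, ← mul_assoc, hS.el3, smul_mul_assoc]

theorem star_mul_initialProj (i j : I) : star (S j) * initialProj S i = A i j • star (S j) := by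
  have := congrArg star (hS.initialProj_mul i j)
  rwa [star_mul, star_initialProj, star_zsmul] at this

theorem star_mul_eq_zero {i j : I} (h : i ≠ j) : star (S i) * S j = 0 := by
  rw [← hS.star_mul_finalProj i, ← hS.finalProj_mul j, mul_assoc, ← mul_assoc (finalProj S i),
    hS.el2 i j h, zero_mul, mul_zero]

/-- By (EL3) both products equal `A a b • (S b * q * star (S b))`, whatever `q` is. -/
theorem commute_initialProj_conj (a b : I) (q : R) :
    Commute (initialProj S a) (S b * q * star (S b)) := by
  change _ * _ = _ * _
  rw [mul_assoc _ _ (initialProj S a), hS.star_mul_initialProj, mul_assoc, ← mul_assoc,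
    hS.initialProj_mul, smul_mul_assoc, mul_smul_comm, mul_assoc]

/-! #### Minterms -/

theorem prod_perm_initialProj {l l' : List I} (h : l.Perm l') :
    (l.map (initialProj S)).prod = (l'.map (initialProj S)).prod := by
  refine (h.map _).prod_eq' ?_
  rw [List.pairwise_map]
  exact List.pairwise_of_forall fun a b => hS.el1 a b

theorem commute_one_sub (a b : I) : Commute (1 - initialProj S a) (1 - initialProj S b) :=
  ((Commute.one_left _).sub_left
    ((Commute.one_right _).sub_right (hS.el1 a b)))

theorem prod_perm_one_sub {l l' : List I} (h : l.Perm l') :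
    (l.map fun y => 1 - initialProj S y).prod = (l'.map fun y => 1 - initialProj S y).prod := by
  refine (h.map _).prod_eq' ?_
  rw [List.pairwise_map]
  exact List.pairwise_of_forall fun a b => hS.commute_one_sub a b

theorem minterm_insert_left [DecidableEq I] {a : I} {X : Finset I} (ha : a ∉ X) (Y : Finset I) :
    minterm S (insert a X) Y = initialProj S a * minterm S X Y := by
  rw [minterm, hS.prod_perm_initialProj (Finset.toList_insert ha), List.map_cons,
    List.prod_cons, minterm, mul_assoc]

theorem minterm_insert_right [DecidableEq I] {a : I} {Y : Finset I} (ha : a ∉ Y) (X : Finset I) :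
    minterm S X (insert a Y) = (1 - initialProj S a) * minterm S X Y := by
  rw [minterm, hS.prod_perm_one_sub (Finset.toList_insert ha), List.map_cons,
    List.prod_cons, minterm, ← mul_assoc, ← mul_assoc]
  congr 1
  refine ((Commute.list_prod_right _ _ ?_).eq).symm
  simp only [List.mem_map]
  rintro _ ⟨b, -, rfl⟩
  exact (Commute.one_left _).sub_left (hS.el1 a b)

theorem one_sub_mul_minterm {a : I} {X : Finset I} (ha : a ∈ X) (Y : Finset I) :
    (1 - initialProj S a) * minterm S X Y = 0 := by
  classical
  rw [← Finset.insert_erase ha, hS.minterm_insert_left (Finset.notMem_erase a X), ← mul_assoc,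
    sub_mul, hS.initialProj_idem, one_mul, sub_self, zero_mul]

theorem mul_minterm_eq_zero {a : I} {Y : Finset I} (ha : a ∈ Y) (X : Finset I) :
    initialProj S a * minterm S X Y = 0 := by
  classical
  rw [← Finset.insert_erase ha, hS.minterm_insert_right (Finset.notMem_erase a Y), ← mul_assoc,
    mul_sub, hS.initialProj_idem, mul_one, sub_self, zero_mul]

/-- An element that is annihilated by all the minterms over a finite set of indices vanishes. -/
theorem eq_zero_of_mul_minterm [DecidableEq I] {r : R} (T : Finset I)
    (h : ∀ X Y, T ⊆ X ∪ Y → r * minterm S X Y = 0) : r = 0 := by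
  suffices ∀ X Y, r * minterm S X Y = 0 by simpa [minterm] using this ∅ ∅
  induction T using Finset.induction_on with
  | empty => exact fun X Y => h X Y (Finset.empty_subset _)
  | insert a T _ ih =>
    refine ih fun X Y hT => ?_
    by_cases ha : a ∈ X ∪ Y
    · exact h X Y (Finset.insert_subset ha hT)
    · rw [Finset.mem_union, not_or] at ha
      -- The minterm over `X, Y` is the sum of these two, since `1` is the sum of the initial
      -- projection of `a` and its complement.
      have h1 := h (insert a X) Y (by grind)
      have h2 := h X (insert a Y) (by grind)
      rw [hS.minterm_insert_left ha.1] at h1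
      rw [hS.minterm_insert_right ha.2, sub_mul, one_mul, mul_sub, h1, sub_zero] at h2
      exact h2

/-! #### Complements of final projections -/

theorem finalProj_mul_finalCompl {j : I} {F : Finset I} (hj : j ∈ F) :
    finalProj S j * finalCompl S F = 0 := by
  rw [finalCompl, mul_sub, mul_one, Finset.mul_sum,
    Finset.sum_eq_single_of_mem j hj fun i _ hi => hS.el2 _ _ hi.symm, hS.finalProj_idem, sub_self]

/-- (EL4) in the form of an inequality between projections. -/
theorem minterm_mul_finalCompl {X Y F : Finset I} (h : ∀ j, coeff A X Y j ≠ 0 → j ∈ F) :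
    minterm S X Y * finalCompl S F = 0 := by
  have hfin : {j | coeff A X Y j ≠ 0}.Finite := F.finite_toSet.subset h
  rw [hS.el4 X Y hfin, Finset.sum_mul]
  refine Finset.sum_eq_zero fun j hj => ?_
  rw [smul_mul_assoc, hS.finalProj_mul_finalCompl (h j (by simpa using hj)), smul_zero]

end IsFamily

/-! #### Sets of paths -/

variable (A) in
/-- The infinite paths of `A`. -/
abbrev Path : Type _ := (markovSubshift A).carrier

theorem mem_carrier_iff (x : Stream' I) :
    x ∈ (markovSubshift A).carrier ↔ A x.head x.tail.head = 1 ∧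
      x.tail ∈ (markovSubshift A).carrier := by
  constructor
  · exact fun h => ⟨h 0, fun n => h (n + 1)⟩
  · rintro ⟨h0, h⟩ (_ | n)
    exacts [h0, h n]

theorem cons_mem_carrier_iff (j : I) (x : Stream' I) :
    Stream'.cons j x ∈ (markovSubshift A).carrier ↔ A j x.head = 1 ∧
      x ∈ (markovSubshift A).carrier :=
  mem_carrier_iff _

variable (A) in
/-- The paths that can be preceded by `a`. -/
def followers (a : I) : Set (Path A) := {x | A a x.1.head = 1}

/-- The paths `b x` with `x ∈ E`. -/
def consSet (b : I) (E : Set (Path A)) : Set (Path A) :=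
  {y | y.1.head = b ∧ ∃ h, (⟨y.1.tail, h⟩ : Path A) ∈ E}

/-- The paths `x` with `j x ∈ E`. -/
def cutSet (j : I) (E : Set (Path A)) : Set (Path A) :=
  {x | ∃ h, (⟨Stream'.cons j x.1, h⟩ : Path A) ∈ E}

/-- The complement is relative to `followers A j`, because prepending `j` to a path gives a path
only there. -/
theorem cutSet_compl (j : I) (E : Set (Path A)) :
    cutSet j Eᶜ = followers A j ∩ (cutSet j E)ᶜ := by
  ext x
  simp only [cutSet, followers, Set.mem_ofPred_eq, Set.mem_inter_iff, Set.mem_compl_iff,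
    cons_mem_carrier_iff, not_exists]
  constructor
  · rintro ⟨h, hx⟩
    exact ⟨h.1, fun _ => hx⟩
  · rintro ⟨h, hx⟩
    exact ⟨⟨h, x.2⟩, hx ⟨h, x.2⟩⟩

theorem cutSet_inter (j : I) (E F : Set (Path A)) :
    cutSet j (E ∩ F) = cutSet j E ∩ cutSet j F := by
  ext x
  simp only [cutSet, Set.mem_ofPred_eq, Set.mem_inter_iff]
  exact ⟨fun ⟨h, h1, h2⟩ => ⟨⟨h, h1⟩, h, h2⟩, fun ⟨⟨h, h1⟩, _, h2⟩ => ⟨h, h1, h2⟩⟩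

theorem cutSet_univ (j : I) : cutSet j (Set.univ : Set (Path A)) = followers A j := by
  ext x
  simp [cutSet, followers, cons_mem_carrier_iff]

theorem cutSet_empty (j : I) : cutSet j (∅ : Set (Path A)) = ∅ := by
  ext x
  simp [cutSet]

theorem cutSet_followers_of_one {a j : I} (h : A a j = 1) :
    cutSet j (followers A a) = followers A j := by
  ext x
  simp [cutSet, followers, cons_mem_carrier_iff, h]

theorem cutSet_followers_of_zero {a j : I} (h : A a j = 0) : cutSet j (followers A a) = ∅ := by
  ext x
  simp [cutSet, followers, h]

theorem cutSet_consSet_self (b : I) (E : Set (Path A)) :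
    cutSet b (consSet b E) = followers A b ∩ E := by
  ext x
  simp [cutSet, consSet, followers, cons_mem_carrier_iff]

theorem cutSet_consSet_of_ne {j b : I} (h : j ≠ b) (E : Set (Path A)) :
    cutSet j (consSet b E) = ∅ := by
  ext x
  simp [cutSet, consSet, h]

/-- Iterating a choice of successor never gets stuck. Every use of the absence of zero rows passes
through this lemma. -/
theorem exists_path (hA01 : ∀ i j, A i j = 0 ∨ A i j = 1) (hrow : ∀ i, ∃ j, A i j ≠ 0) (i : I) :
    ∃ x : Path A, x.1.head = i := by
  choose f hf using hrow
  refine ⟨⟨fun n => f^[n] i, fun n => ?_⟩, rfl⟩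
  change A (f^[n] i) (f^[n + 1] i) = 1
  rw [Function.iterate_succ_apply']
  exact (hA01 _ _).resolve_left (hf _)

end ExelLaca

/-! ### The correspondence between sets of paths and projections. -/

namespace ExelLaca

variable {I R : Type*} [Ring R] [StarRing R] {A : Matrix I I ℤ} {S : I → R}

/-- The correspondence between sets of paths and projections, generated from that between
`followers A a` and `S_a^* S_a` by Boolean operations and by passing from `(E, q)` to
`(bE, S_b q S_b^*)`. The natural number bounds the number of nested passages. -/
inductive Graph (A : Matrix I I ℤ) (S : I → R) : ℕ → Set (Path A) → R → Prop
  | univ (n : ℕ) : Graph A S n Set.univ 1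
  | followers (n : ℕ) (a : I) : Graph A S n (followers A a) (initialProj S a)
  | compl {n : ℕ} {E : Set (Path A)} {q : R} : Graph A S n E q → Graph A S n Eᶜ (1 - q)
  | inter {n : ℕ} {E F : Set (Path A)} {q r : R} :
      Graph A S n E q → Graph A S n F r → Graph A S n (E ∩ F) (q * r)
  | cons {n : ℕ} {E : Set (Path A)} {q : R} (b : I) :
      Graph A S n E q → Graph A S (n + 1) (consSet b E) (S b * q * star (S b))

namespace Graph

variable {n m : ℕ} {E F : Set (Path A)} {q r : R}

theorem empty (n : ℕ) : Graph A S n ∅ 0 := by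
  simpa using (Graph.univ (A := A) (S := S) n).compl

/-- `inter` asks for a common depth bound, so bounds must be raisable before two pairs can be
combined. -/
theorem mono (h : Graph A S n E q) (hnm : n ≤ m) : Graph A S m E q := by
  induction h generalizing m with
  | univ n => exact .univ m
  | followers n a => exact .followers m a
  | compl _ ih => exact (ih hnm).compl
  | inter _ _ ih ih' => exact (ih hnm).inter (ih' hnm)
  | cons b _ ih =>
    obtain ⟨m, rfl⟩ := Nat.exists_eq_add_of_le' (Nat.le_of_add_left_le hnm)
    exact (ih (by omega)).cons b

theorem commute_initialProj (hS : IsFamily A S) (h : Graph A S n E q) (a : I) :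
    Commute q (initialProj S a) := by
  induction h with
  | univ n => exact Commute.one_left _
  | followers n b => exact hS.el1 b a
  | compl _ ih => exact (Commute.one_left _).sub_left ih
  | inter _ _ ih ih' => exact ih.mul_left ih'
  | cons b _ _ => exact (hS.commute_initialProj_conj a b _).symm

/-- Only two `cons` elements need work. For different first letters both products vanish; for the
same letter the product is `S_b` times `q (S_b^* S_b) r` times `S_b^*`, whose three inner factors
commute by induction. -/
theorem commute (hS : IsFamily A S) (h : Graph A S n E q) (h' : Graph A S m F r) :
    Commute q r := by
  induction h generalizing m F r with
  | univ n => exact Commute.one_left _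
  | followers n a => exact (h'.commute_initialProj hS a).symm
  | compl _ ih => exact (Commute.one_left _).sub_left (ih h')
  | inter _ _ ih ih' => exact (ih h').mul_left (ih' h')
  | @cons n E q b h ih =>
    induction h' with
    | univ n => exact Commute.one_right _
    | followers n a => exact (hS.commute_initialProj_conj a b _).symm
    | compl _ ih => exact (Commute.one_right _).sub_right ih
    | inter _ _ ih ih' => exact ih.mul_right ih'
    | @cons m F r c h' _ =>
      have expand : ∀ (b c : I) (x y : R), S b * x * star (S b) * (S c * y * star (S c)) =
          S b * (x * (star (S b) * S c) * y) * star (S c) := fun b c x y => by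
        simp only [mul_assoc]
      change _ * _ = _ * _
      rw [expand, expand]
      by_cases hbc : b = c
      · subst hbc
        have hr := h'.commute_initialProj hS b
        rw [← initialProj, mul_assoc q, ← hr.eq, ← mul_assoc q, (ih h').eq, mul_assoc r q,
          (h.commute_initialProj hS b).eq, ← mul_assoc r]
      · rw [hS.star_mul_eq_zero hbc, hS.star_mul_eq_zero (Ne.symm hbc)]
        simp

theorem commute_finalProj (hS : IsFamily A S) (h : Graph A S n E q) (j : I) :
    Commute q (finalProj S j) := by
  have := h.commute hS ((Graph.univ 0).cons j)
  rwa [mul_one] at this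

theorem star_eq (hS : IsFamily A S) (h : Graph A S n E q) : star q = q := by
  induction h with
  | univ n => exact star_one R
  | followers n a => exact star_initialProj a
  | compl _ ih => rw [star_sub, star_one, ih]
  | inter h h' ih ih' => rw [star_mul, ih, ih', (h.commute hS h').eq]
  | cons b _ ih => rw [star_mul, star_mul, star_star, ih, mul_assoc]

theorem idem (hS : IsFamily A S) (h : Graph A S n E q) : q * q = q := by
  induction h with
  | univ n => exact one_mul 1
  | followers n a => exact hS.initialProj_idem a
  | compl _ ih => rw [mul_sub, sub_mul, sub_mul, ih]; simp
  | @inter n E F q r h h' ih ih' =>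
    rw [mul_assoc, ← mul_assoc r, ← (h.commute hS h').eq, mul_assoc q, ih', ← mul_assoc, ih]
  | @cons n E q b h ih =>
    calc _ = S b * (q * initialProj S b * q) * star (S b) := by
          simp only [mul_assoc, initialProj]
      _ = _ := by
          rw [(h.commute_initialProj hS b).eq, mul_assoc (initialProj S b), ih, ← mul_assoc,
            hS.mul_initialProj]

/-- Compression by `S_j` is multiplicative here because `q` commutes with `S_j S_j^*`, so it follows
the Boolean operations; on a `cons` it strips the outer letter, lowering the depth. At depth `0` the
truncated `n - 1` is harmless: only followers occur, and these cut to followers or to `∅`. -/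
theorem cut (hA01 : ∀ i j, A i j = 0 ∨ A i j = 1) (hS : IsFamily A S) (h : Graph A S n E q)
    (j : I) : Graph A S (n - 1) (cutSet j E) (star (S j) * q * S j) := by
  induction h with
  | univ n =>
    rw [cutSet_univ, mul_one]
    exact .followers _ j
  | followers n a =>
    rw [hS.star_mul_initialProj, smul_mul_assoc]
    rcases hA01 a j with h | h
    · rw [h, zero_smul, cutSet_followers_of_zero h]
      exact .empty _
    · rw [h, one_smul, cutSet_followers_of_one h]
      exact .followers _ j
  | @compl n E q h ih =>
    have e : star (S j) * (1 - q) * S j = initialProj S j * (1 - star (S j) * q * S j) := by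
      rw [mul_sub, mul_sub, sub_mul, mul_one, mul_one, ← mul_assoc, ← mul_assoc,
        hS.initialProj_mul_star, initialProj]
    rw [cutSet_compl, e]
    exact (Graph.followers _ j).inter ih.compl
  | @inter n E F q r h h' ih ih' =>
    have e : star (S j) * (q * r) * S j = star (S j) * q * S j * (star (S j) * r * S j) := by
      calc _ = star (S j) * finalProj S j * (q * r) * S j := by rw [hS.star_mul_finalProj]
        _ = star (S j) * (finalProj S j * q) * r * S j := by simp only [mul_assoc]
        _ = _ := by rw [← (h.commute_finalProj hS j).eq]; simp only [mul_assoc, finalProj]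
    rw [cutSet_inter, e]
    exact ih.inter ih'
  | @cons n E q b h _ =>
    have e : star (S j) * (S b * q * star (S b)) * S j =
        star (S j) * S b * q * (star (S b) * S j) := by simp only [mul_assoc]
    rw [e]
    by_cases hjb : j = b
    · subst hjb
      rw [cutSet_consSet_self, ← initialProj, mul_assoc, (h.commute_initialProj hS j).eq,
        ← mul_assoc, hS.initialProj_idem]
      exact (Graph.followers n j).inter h
    · rw [hS.star_mul_eq_zero hjb, zero_mul, zero_mul, cutSet_consSet_of_ne hjb]
      exact .empty _

/-- Away from finitely many initial letters, `(E, q)` is determined by the minterms over a finite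
set of indices: each of them is contained in or disjoint from `(E, q)`. -/
theorem exists_finite_determining [DecidableEq I] (hS : IsFamily A S)
    (hA01 : ∀ i j, A i j = 0 ∨ A i j = 1) (h : Graph A S n E q) :
    ∃ F T : Finset I, (n = 0 → F = ∅) ∧ ∀ F' X Y, F ⊆ F' → T ⊆ X ∪ Y →
      ((∀ x ∈ E, coeff A X Y x.1.head ≠ 0 → x.1.head ∈ F') ∧
        q * (minterm S X Y * finalCompl S F') = 0) ∨
      ((∀ x ∉ E, coeff A X Y x.1.head ≠ 0 → x.1.head ∈ F') ∧
        (1 - q) * (minterm S X Y * finalCompl S F') = 0) := by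
  -- Allowing every `F' ⊇ F` and every `X, Y` covering `T` makes the property stable under enlarging
  -- `F` and `T`, so intersections can use unions. The clause for `n = 0` starts the later induction
  -- on depth.
  induction h with
  | univ n => exact ⟨∅, ∅, fun _ => rfl, fun F' X Y _ _ => .inr (by simp)⟩
  | followers n a =>
    refine ⟨∅, {a}, fun _ => rfl, fun F' X Y _ hT => ?_⟩
    -- If `a ∈ X` the minterm lies below the initial projection of `a`; if `a ∈ Y` it is orthogonal
    -- to it.
    rcases Finset.mem_union.1 (Finset.singleton_subset_iff.1 hT) with ha | ha
    · right
      refine ⟨fun x hx h => (h ?_).elim, ?_⟩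
      · rw [coeff, Finset.prod_eq_zero ha ((hA01 a x.1.head).resolve_right hx), zero_mul]
      · rw [← mul_assoc, hS.one_sub_mul_minterm ha, zero_mul]
    · left
      refine ⟨fun x hx h => (h ?_).elim, ?_⟩
      · have hx : A a x.1.head = 1 := hx
        rw [coeff, Finset.prod_eq_zero ha (by rw [hx, sub_self]), mul_zero]
      · rw [← mul_assoc, hS.mul_minterm_eq_zero ha, zero_mul]
  | compl _ ih =>
    obtain ⟨F, T, h0, h⟩ := ih
    refine ⟨F, T, h0, fun F' X Y hF hT => (h F' X Y hF hT).symm.imp id ?_⟩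
    rintro ⟨h1, h2⟩
    exact ⟨fun x hx => h1 x (not_not.1 hx), by rwa [sub_sub_cancel]⟩
  | @inter n E₁ E₂ q r h h' ih ih' =>
    obtain ⟨F₁, T₁, h₁0, h₁⟩ := ih
    obtain ⟨F₂, T₂, h₂0, h₂⟩ := ih'
    refine ⟨F₁ ∪ F₂, T₁ ∪ T₂, fun hn => by rw [h₁0 hn, h₂0 hn, Finset.union_empty],
      fun F' X Y hF hT => ?_⟩
    rcases h₁ F' X Y (Finset.union_subset_left hF) (Finset.union_subset_left hT) with
      ⟨hE, hq⟩ | ⟨hE, hq⟩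
    · left
      refine ⟨fun x hx => hE x hx.1, ?_⟩
      rw [(h.commute hS h').eq, mul_assoc, hq, mul_zero]
    rcases h₂ F' X Y (Finset.union_subset_right hF) (Finset.union_subset_right hT) with
      ⟨hE', hr⟩ | ⟨hE', hr⟩
    · left
      refine ⟨fun x hx => hE' x hx.2, ?_⟩
      rw [mul_assoc, hr, mul_zero]
    · right
      refine ⟨fun x hx => ?_, ?_⟩
      · by_cases hx1 : x ∈ E₁
        · exact hE' x fun hx2 => hx ⟨hx1, hx2⟩
        · exact hE x hx1
      · have e : 1 - q * r = (1 - q) + q * (1 - r) := by noncomm_ring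
        rw [e, add_mul, hq, mul_assoc, hr, mul_zero, add_zero]
  | @cons n E q b h _ =>
    -- The element lives under the final projection of `b`, so discarding the first letter `b` kills
    -- it without any condition on the minterm.
    refine ⟨{b}, ∅, fun hn => by omega, fun F' X Y hF _ => ?_⟩
    have hb : b ∈ F' := Finset.singleton_subset_iff.1 hF
    left
    refine ⟨fun x hx _ => hx.1 ▸ hb, ?_⟩
    have hc : Commute (S b * q * star (S b)) (minterm S X Y) :=
      commute_minterm ((h.cons b).commute_initialProj hS) X Y
    rw [← mul_assoc, hc.eq, mul_assoc, ← hS.star_mul_finalProj b, ← mul_assoc (S b * q),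
      mul_assoc _ (finalProj S b), hS.finalProj_mul_finalCompl hb]
    simp

/-- An element that corresponds to the empty set is carried by finitely many final projections. -/
theorem exists_mul_finalCompl_eq_zero (hA01 : ∀ i j, A i j = 0 ∨ A i j = 1)
    (hrow : ∀ i, ∃ j, A i j ≠ 0) (hS : IsFamily A S) (h : Graph A S n ∅ q) :
    ∃ F : Finset I, (n = 0 → F = ∅) ∧ q * finalCompl S F = 0 := by
  classical
  obtain ⟨F, T, h0, hT⟩ := h.exists_finite_determining hS hA01
  refine ⟨F, h0, hS.eq_zero_of_mul_minterm T fun X Y hXY => ?_⟩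
  have hF : Commute (finalCompl S F) (minterm S X Y) :=
    (Commute.one_left _).sub_left <| Commute.sum_left _ _ _ fun j _ =>
      commute_minterm (fun a => by
        simpa [finalProj] using (hS.commute_initialProj_conj a j 1).symm) X Y
  rw [mul_assoc, hF.eq]
  rcases hT F X Y subset_rfl hXY with ⟨-, hq⟩ | ⟨hE, -⟩
  · exact hq
  -- Every path is outside `∅`, and every letter starts a path; hence the coefficient vanishes off
  -- `F` and (EL4) applies.
  · rw [hS.minterm_mul_finalCompl, mul_zero]
    intro j hj
    obtain ⟨x, rfl⟩ := exists_path hA01 hrow j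
    exact hE x (Set.notMem_empty x) hj

/-- At depth `0` no final projection is needed, so `q` itself vanishes. At depth `n + 1` the corner
`star (S j) * q * S j` is paired with `cutSet j ∅ = ∅` at depth `n`, so `q` kills every final
projection, in particular the finitely many that carry it. -/
theorem eq_zero_of_empty (hA01 : ∀ i j, A i j = 0 ∨ A i j = 1) (hrow : ∀ i, ∃ j, A i j ≠ 0)
    (hS : IsFamily A S) (h : Graph A S n ∅ q) : q = 0 := by
  obtain ⟨F, h0, hF⟩ := h.exists_mul_finalCompl_eq_zero hA01 hrow hS
  induction n generalizing q F with
  | zero => simpa [h0 rfl, finalCompl] using hF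
  | succ n ih =>
    have hj : ∀ j, q * finalProj S j = 0 := fun j => by
      have hcut := h.cut hA01 hS j
      rw [cutSet_empty] at hcut
      obtain ⟨F', h0', hF'⟩ := hcut.exists_mul_finalCompl_eq_zero hA01 hrow hS
      have hz := ih hcut F' h0' hF'
      calc q * finalProj S j = finalProj S j * q * finalProj S j := by
            rw [← (h.commute_finalProj hS j).eq, mul_assoc, hS.finalProj_idem]
        _ = S j * (star (S j) * q * S j) * star (S j) := by simp only [finalProj, mul_assoc]
        _ = 0 := by rw [hz, mul_zero, zero_mul]
    rw [finalCompl, mul_sub, mul_one, Finset.mul_sum, Finset.sum_eq_zero fun j _ => hj j,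
      sub_zero] at hF
    exact hF

/-- The correspondence is single-valued. -/
theorem unique (hA01 : ∀ i j, A i j = 0 ∨ A i j = 1) (hrow : ∀ i, ∃ j, A i j ≠ 0)
    (hS : IsFamily A S) (h : Graph A S n E q) (h' : Graph A S m E r) : q = r := by
  have aux : ∀ {q r : R} {n m : ℕ}, Graph A S n E q → Graph A S m E r → q * r = q := by
    intro q r n m h h'
    -- `q * (1 - r)` is paired with `E ∩ Eᶜ = ∅`, whence `q ≤ r`; symmetry and commutation give
    -- equality.
    have h0 := (h.mono (le_max_left n m)).inter (h'.mono (le_max_right n m)).compl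
    rw [Set.inter_compl_self] at h0
    have := h0.eq_zero_of_empty hA01 hrow hS
    rw [mul_sub, mul_one, sub_eq_zero] at this
    exact this.symm
  rw [← aux h h', (h.commute hS h').eq, aux h' h]

/-! #### The sets `C(α, β)` -/

/-- For empty `β`, repeated use of `S_a^* S_a S_c = A_{ac} S_c` collapses `S_α^* S_α` to the initial
projection of the last letter of `α`, or to zero if `α` has a forbidden transition. Each letter of
`β` is then one `cons`. -/
theorem exists_C (hA01 : ∀ i j, A i j = 0 ∨ A i j = 1) (hS : IsFamily A S) (α β : List I) :
    ∃ n, Graph A S n ((markovSubshift A).C α β)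
      ((β.map S).prod * star (α.map S).prod * (α.map S).prod * star (β.map S).prod) := by
  induction β with
  | nil =>
    simp only [List.map_nil, List.prod_nil, one_mul, star_one, mul_one]
    refine ⟨0, ?_⟩
    induction α with
    | nil =>
      convert! Graph.univ 0 using 1
      · ext x
        simp [Subshift.C, Stream'.appendStream']
      · simp
    | cons a α ih =>
      cases α with
      | nil =>
        convert! Graph.followers 0 a using 1
        · ext x
          simp [Subshift.C, Stream'.appendStream', cons_mem_carrier_iff, ExelLaca.followers]
        · simp [initialProj]
      | cons c α =>
        have e : star (List.map S (a :: c :: α)).prod * (List.map S (a :: c :: α)).prod =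
            A a c • (star (List.map S (c :: α)).prod * (List.map S (c :: α)).prod) := by
          have e' : star (List.map S (a :: c :: α)).prod * (List.map S (a :: c :: α)).prod =
              star (List.map S (c :: α)).prod * (initialProj S a * S c) * (α.map S).prod := by
            simp only [List.map_cons, List.prod_cons, star_mul, initialProj, mul_assoc]
          rw [e', hS.initialProj_mul, mul_smul_comm, smul_mul_assoc, mul_assoc]
          rfl
        have hC : ∀ x, x ∈ (markovSubshift A).C (a :: c :: α) [] ↔
            A a c = 1 ∧ x ∈ (markovSubshift A).C (c :: α) [] := fun x => by
          simp [Subshift.C, Stream'.appendStream', cons_mem_carrier_iff]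
        rw [e]
        rcases hA01 a c with h | h
        · convert! Graph.empty 0 using 1
          · ext x
            simp [hC, h]
          · simp [h]
        · convert! ih using 1
          · ext x
            simp [hC, h]
          · rw [h, one_smul]
  | cons b β ih =>
    obtain ⟨n, hn⟩ := ih
    refine ⟨n + 1, ?_⟩
    convert! hn.cons b using 1
    · ext ⟨x, hx⟩
      simp only [Subshift.C, consSet, Set.mem_ofPred_eq]
      constructor
      · rintro ⟨z, rfl, hz⟩
        exact ⟨rfl, ((mem_carrier_iff _).1 hx).2, z, rfl, hz⟩
      · rintro ⟨rfl, -, z, hz, hα⟩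
        refine ⟨z, ?_, hα⟩
        rw [Stream'.cons_append_stream, ← hz, Stream'.eta]
    · simp only [List.map_cons, List.prod_cons, star_mul, mul_assoc]

theorem exists_of_mem_U (hA01 : ∀ i j, A i j = 0 ∨ A i j = 1) (hS : IsFamily A S)
    {E : Set (Path A)} (hE : E ∈ (markovSubshift A).U) : ∃ n q, Graph A S n E q := by
  induction hE using BooleanSubalgebra.closure_bot_sup_induction with
  | mem E h =>
    obtain ⟨α, -, β, -, rfl⟩ := h
    obtain ⟨n, h⟩ := exists_C hA01 hS α β
    exact ⟨n, _, h⟩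
  | bot => exact ⟨0, 0, .empty 0⟩
  | sup E _ F _ ih ih' =>
    obtain ⟨n, q, h⟩ := ih
    obtain ⟨m, r, h'⟩ := ih'
    -- Unions come from De Morgan, as `Graph` has only complements and intersections.
    have := ((h.mono (le_max_left n m)).compl.inter (h'.mono (le_max_right n m)).compl).compl
    rw [← Set.compl_union, compl_compl] at this
    exact ⟨_, _, this⟩
  | compl E _ ih =>
    obtain ⟨n, q, h⟩ := ih
    exact ⟨n, _, h.compl⟩

end Graph

/-- The projection that corresponds to a set in the Boolean algebra of the Markov subshift. -/
noncomputable def setProj (hA01 : ∀ i j, A i j = 0 ∨ A i j = 1) (hS : IsFamily A S)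
    (E : (markovSubshift A).U) : R := (Graph.exists_of_mem_U hA01 hS E.2).choose_spec.choose

theorem exists_graph_setProj (hA01 : ∀ i j, A i j = 0 ∨ A i j = 1) (hS : IsFamily A S)
    (E : (markovSubshift A).U) : ∃ n, Graph A S n E (setProj hA01 hS E) :=
  ⟨_, (Graph.exists_of_mem_U hA01 hS E.2).choose_spec.choose_spec⟩

/-- Single-valuedness makes the choice in `setProj` immaterial: any derivation in `Graph` computes
its value. -/
theorem setProj_eq (hA01 : ∀ i j, A i j = 0 ∨ A i j = 1) (hrow : ∀ i, ∃ j, A i j ≠ 0)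
    (hS : IsFamily A S) {E : (markovSubshift A).U} {n : ℕ} {q : R}
    (h : Graph A S n E q) : setProj hA01 hS E = q :=
  (exists_graph_setProj hA01 hS E).choose_spec.unique hA01 hrow hS h

end ExelLaca

/-! ### Families and the relations of the presentation. -/

namespace ExelLaca

open FreeStarAlg CStarPresentation

variable {I : Type*} {A : Matrix I I ℤ}

theorem IsFamily.lift_eq_of_rel {B : Type*} [CStarAlgebra B] {S : I → B} (hS : IsFamily A S)
    {a b : FreeStarAlg I} (h : Rel A a b) : lift S a = lift S b := by
  have hl : ∀ i, lift S (ExelLaca.S i) = S i := lift_gen S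
  cases h <;> simp only [map_mul, map_star, map_zsmul, map_zero, map_one, map_sub, map_list_prod, List.map_map,
    map_sum, Function.comp_def, hl]
  case partialIsometry i => exact hS.partialIsometry i
  case el1 i j => exact hS.el1 i j
  case el2 i j hij => exact hS.el2 i j hij
  case el3 i j => exact hS.el3 i j
  case el4 X Y h => exact hS.el4 X Y h

theorem isFamily_ofHom : IsFamily A fun i => (presentation A).ofHom (S i) := by
  have key : ∀ {a b : FreeStarAlg I}, Rel A a b →
      (presentation A).ofHom a = (presentation A).ofHom b :=
    fun h => (presentation A).ofHom_eq_of_rel h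
  refine ⟨fun i => ?_, fun i j => ?_, fun i j hij => ?_, fun i j => ?_, fun X Y h => ?_⟩
  · have h := key (Rel.partialIsometry i)
    simp only [map_mul, map_star] at h
    exact h
  · have h := key (Rel.el1 i j)
    simp only [map_mul, map_star] at h
    exact h
  · have h := key (Rel.el2 i j hij)
    simp only [map_mul, map_star, map_zero] at h
    exact h
  · have h := key (Rel.el3 i j)
    simp only [map_mul, map_star, map_zsmul] at h
    exact h
  · have h' := key (Rel.el4 X Y h)
    simp only [map_mul, map_star, map_zsmul, map_one, map_sub, map_list_prod,
      List.map_map, map_sum, Function.comp_def] at h'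
    exact h'

theorem coeff_eq_one (hA01 : ∀ i j, A i j = 0 ∨ A i j = 1) {X Y : Finset I} {j : I}
    (h : coeff A X Y j ≠ 0) : coeff A X Y j = 1 := by
  rw [coeff, mul_ne_zero_iff, Finset.prod_ne_zero_iff, Finset.prod_ne_zero_iff] at h
  rw [coeff, Finset.prod_eq_one, Finset.prod_eq_one, one_mul]
  · intro y hy
    rcases hA01 y j with h' | h'
    · rw [h', sub_zero]
    · exact (h.2 y hy (by rw [h', sub_self])).elim
  · exact fun x hx => (hA01 x j).resolve_left (h.1 x hx)

theorem coeff_ne_zero_iff (hA01 : ∀ i j, A i j = 0 ∨ A i j = 1) {X Y : Finset I} {j : I} :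
    coeff A X Y j ≠ 0 ↔ (∀ x ∈ X, A x j = 1) ∧ ∀ y ∈ Y, A y j ≠ 1 := by
  rw [coeff, mul_ne_zero_iff, Finset.prod_ne_zero_iff, Finset.prod_ne_zero_iff]
  refine and_congr (forall₂_congr fun x _ => ?_) (forall₂_congr fun y _ => ?_)
  · rcases hA01 x j with h | h <;> simp [h]
  · rcases hA01 y j with h | h <;> simp [h]

end ExelLaca

/-! ### Boolean calculus of the projections of the subshift algebra. -/

namespace Subshift

open FreeStarAlg CStarPresentation

variable {𝒜 : Type*} (X : Subshift 𝒜)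

/-- The projection `p_E` of the unital subshift C⋆-algebra. -/
noncomputable def proj (E : X.U) : X.UnitalCStarAlg := X.presentation.ofHom (X.p E)

/-- The partial isometry `s_a` of the unital subshift C⋆-algebra. -/
noncomputable def iso (a : 𝒜) : X.UnitalCStarAlg := X.presentation.ofHom (X.s a)

variable {X}

theorem proj_top : X.proj ⊤ = 1 := by
  simpa using! X.presentation.ofHom_eq_of_rel Rel.p_univ

theorem proj_bot : X.proj ⊥ = 0 := by
  simpa using! X.presentation.ofHom_eq_of_rel Rel.p_empty

theorem proj_inf (E F : X.U) : X.proj (E ⊓ F) = X.proj E * X.proj F := by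
  simpa using! X.presentation.ofHom_eq_of_rel (Rel.p_inter E F)

theorem proj_sup (E F : X.U) : X.proj (E ⊔ F) = X.proj E + X.proj F - X.proj (E ⊓ F) := by
  simpa using! X.presentation.ofHom_eq_of_rel (Rel.p_union E F)

theorem proj_compl (E : X.U) : X.proj Eᶜ = 1 - X.proj E := by
  have h := proj_sup E Eᶜ
  rw [sup_compl_eq_top, inf_compl_eq_bot, proj_top, proj_bot, sub_zero] at h
  exact eq_sub_of_add_eq' h.symm

theorem proj_C {α β : List 𝒜} (hα : α ∈ X.language) (hβ : β ∈ X.language) :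
    X.proj ⟨X.C α β, X.C_mem_U hα hβ⟩ = (β.map X.iso).prod * star (α.map X.iso).prod *
      (α.map X.iso).prod * star (β.map X.iso).prod := by
  have h := X.presentation.ofHom_eq_of_rel (Rel.s_word α β hα hβ)
  simp only [map_mul, map_star, sWord, map_list_prod, List.map_map] at h
  exact h.symm

/-- If `q_i = p_{E_i}`, then `∏_i q_i = p_E` with `E = ⋂_i E_i`. -/
theorem exists_proj_eq_prod {ι : Type*} {E : ι → Set X.carrier} {q : ι → X.UnitalCStarAlg}
    (h : ∀ i, ∃ D : X.U, (D : Set X.carrier) = E i ∧ X.proj D = q i) (l : List ι) :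
    ∃ D : X.U, (∀ x, x ∈ (D : Set X.carrier) ↔ ∀ i ∈ l, x ∈ E i) ∧
      X.proj D = (l.map q).prod := by
  induction l with
  | nil => exact ⟨⊤, by simp, by simpa using proj_top⟩
  | cons i l ih =>
    obtain ⟨D, hD, hp⟩ := ih
    obtain ⟨D', hD', hp'⟩ := h i
    refine ⟨D' ⊓ D, fun x => ?_, by rw [proj_inf, hp, hp', List.map_cons, List.prod_cons]⟩
    simp [← hD', ← hD]

/-- If `q_i = p_{E_i}` with `E_i` disjoint, then `∑_i q_i = p_E` with `E = ⋃_i E_i`. -/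
theorem exists_proj_eq_sum {ι : Type*} {E : ι → Set X.carrier} {q : ι → X.UnitalCStarAlg}
    (h : ∀ i, ∃ D : X.U, (D : Set X.carrier) = E i ∧ X.proj D = q i)
    (hE : ∀ i j, i ≠ j → Disjoint (E i) (E j)) (F : Finset ι) :
    ∃ D : X.U, (∀ x, x ∈ (D : Set X.carrier) ↔ ∃ i ∈ F, x ∈ E i) ∧
      X.proj D = ∑ i ∈ F, q i := by
  classical
  induction F using Finset.induction_on with
  | empty => exact ⟨⊥, by simp, by simpa using proj_bot⟩
  | insert i F hi ih =>
    obtain ⟨D, hD, hp⟩ := ih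
    obtain ⟨D', hD', hp'⟩ := h i
    have hdisj : D' ⊓ D = ⊥ := by
      refine Subtype.ext (Set.eq_empty_iff_forall_notMem.2 fun x hx => ?_)
      obtain ⟨j, hj, hxj⟩ := (hD x).1 hx.2
      exact Set.disjoint_left.1 (hE i j fun hij => hi (hij ▸ hj)) (hD' ▸ hx.1) hxj
    refine ⟨D' ⊔ D, fun x => ?_, ?_⟩
    · simp [← hD', ← hD]
    · rw [proj_sup, hdisj, proj_bot, sub_zero, hp, hp', Finset.sum_insert hi]

end Subshift

/-! ### Verification of the relations in both directions. -/

namespace ExelLaca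

open FreeStarAlg CStarPresentation Subshift

variable {I : Type*} {A : Matrix I I ℤ}

theorem nil_mem_language (hA01 : ∀ i j, A i j = 0 ∨ A i j = 1) (hrow : ∀ i, ∃ j, A i j ≠ 0)
    (i : I) : [] ∈ (markovSubshift A).language := by
  obtain ⟨x, -⟩ := exists_path hA01 hrow i
  exact ⟨x.1, x.2, rfl⟩

theorem singleton_mem_language (hA01 : ∀ i j, A i j = 0 ∨ A i j = 1)
    (hrow : ∀ i, ∃ j, A i j ≠ 0) (i : I) : [i] ∈ (markovSubshift A).language := by
  obtain ⟨x, rfl⟩ := exists_path hA01 hrow i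
  exact ⟨x.1, x.2, rfl⟩

/-- This is relation (ii) for `C(i, ω)`. -/
theorem exists_proj_eq_initialProj (hA01 : ∀ i j, A i j = 0 ∨ A i j = 1)
    (hrow : ∀ i, ∃ j, A i j ≠ 0) (i : I) : ∃ D : (markovSubshift A).U,
      (D : Set (Path A)) = followers A i ∧
        (markovSubshift A).proj D = initialProj (markovSubshift A).iso i := by
  refine ⟨⟨_, C_mem_U _ (singleton_mem_language hA01 hrow i) (nil_mem_language hA01 hrow i)⟩,
    ?_, ?_⟩
  · ext x
    simp [C, Stream'.appendStream', cons_mem_carrier_iff, followers]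
  · refine (proj_C (singleton_mem_language hA01 hrow i)
      (nil_mem_language hA01 hrow i)).trans ?_
    simp [initialProj]

/-- This is relation (ii) for `C(ω, i)`; its second condition, that the tail be a path, is
automatic. -/
theorem exists_proj_eq_finalProj (hA01 : ∀ i j, A i j = 0 ∨ A i j = 1)
    (hrow : ∀ i, ∃ j, A i j ≠ 0) (i : I) : ∃ D : (markovSubshift A).U,
      (D : Set (Path A)) = {x | x.1.head = i} ∧
        (markovSubshift A).proj D = finalProj (markovSubshift A).iso i := by
  refine ⟨⟨_, C_mem_U _ (nil_mem_language hA01 hrow i) (singleton_mem_language hA01 hrow i)⟩,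
    ?_, ?_⟩
  · ext ⟨x, hx⟩
    simp only [C, Stream'.appendStream', Set.mem_ofPred_eq]
    constructor
    · rintro ⟨z, rfl, -⟩
      rfl
    · rintro rfl
      exact ⟨x.tail, (Stream'.eta x).symm, ((mem_carrier_iff x).1 hx).2⟩
  · refine (proj_C (nil_mem_language hA01 hrow i)
      (singleton_mem_language hA01 hrow i)).trans ?_
    simp [finalProj]

/-- Apart from the partial isometry relation, each relation equates two projections `p_E`, and holds
because the sets agree. -/
theorem isFamily_iso (hA01 : ∀ i j, A i j = 0 ∨ A i j = 1) (hrow : ∀ i, ∃ j, A i j ≠ 0) :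
    IsFamily A (markovSubshift A).iso where
  partialIsometry i := by
    have h := (markovSubshift A).presentation.ofHom_eq_of_rel
      (Subshift.Rel.s_partialIsometry i)
    simp only [map_mul, map_star] at h
    exact h
  el1 i j := by
    obtain ⟨D, -, hD⟩ := exists_proj_eq_initialProj hA01 hrow i
    obtain ⟨D', -, hD'⟩ := exists_proj_eq_initialProj hA01 hrow j
    rw [← hD, ← hD', ← proj_inf, ← proj_inf, inf_comm]
  el2 i j hij := by
    obtain ⟨D, h, hD⟩ := exists_proj_eq_finalProj hA01 hrow i
    obtain ⟨D', h', hD'⟩ := exists_proj_eq_finalProj hA01 hrow j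
    rw [← hD, ← hD', ← proj_inf, ← proj_bot]
    congr 1
    refine Subtype.ext (Set.eq_empty_iff_forall_notMem.2 fun x hx => hij ?_)
    have h1 : x ∈ {x : Path A | x.1.head = i} := h ▸ hx.1
    have h2 : x ∈ {x : Path A | x.1.head = j} := h' ▸ hx.2
    exact h1.symm.trans h2
  el3 i j := by
    obtain ⟨D, h, hD⟩ := exists_proj_eq_initialProj hA01 hrow i
    obtain ⟨D', h', hD'⟩ := exists_proj_eq_finalProj hA01 hrow j
    rw [← hD, ← hD', ← proj_inf]
    have hmem : ∀ x, x ∈ ((D ⊓ D' : (markovSubshift A).U) : Set (Path A)) ↔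
        A i x.1.head = 1 ∧ x.1.head = j := fun x => by
      change x ∈ (D : Set (Path A)) ∩ D' ↔ _
      rw [h, h']
      rfl
    rcases hA01 i j with hij | hij
    · rw [hij, zero_smul, ← proj_bot]
      congr 1
      refine Subtype.ext (Set.eq_empty_iff_forall_notMem.2 fun x hx => ?_)
      obtain ⟨h1, rfl⟩ := (hmem x).1 hx
      simp [h1] at hij
    · rw [hij, one_smul]
      congr 1
      refine Subtype.ext (Set.ext fun x => ?_)
      rw [hmem, h']
      exact ⟨fun hx => hx.2, fun hx => ⟨by rw [show x.1.head = j from hx, hij], hx⟩⟩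
  el4 X Y h := by
    obtain ⟨D, hD, hp⟩ :=
      exists_proj_eq_prod (exists_proj_eq_initialProj hA01 hrow) X.toList
    obtain ⟨D', hD', hp'⟩ := exists_proj_eq_prod
      (E := fun i => (followers A i)ᶜ) (q := fun i => 1 - initialProj (markovSubshift A).iso i)
      (fun i => by
        obtain ⟨D, h, hD⟩ := exists_proj_eq_initialProj hA01 hrow i
        exact ⟨Dᶜ, by rw [← h]; rfl, by rw [proj_compl, hD]⟩) Y.toList
    obtain ⟨D'', hD'', hp''⟩ := exists_proj_eq_sum (exists_proj_eq_finalProj hA01 hrow)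
      (fun i j hij => Set.disjoint_left.2 fun x hi hj => hij (Eq.trans (Eq.symm hi) hj))
      h.toFinset
    -- Nonzero coefficients are `1`, so the right side of (EL4) is the projection of a disjoint
    -- union of cylinders.
    have hsum : ∑ j ∈ h.toFinset, coeff A X Y j • finalProj (markovSubshift A).iso j =
        ∑ j ∈ h.toFinset, finalProj (markovSubshift A).iso j :=
      Finset.sum_congr rfl fun j hj => by
        rw [coeff_eq_one hA01 (by simpa using hj), one_smul]
    rw [hsum, minterm, ← hp, ← hp', ← hp'', ← proj_inf]
    congr 1
    refine Subtype.ext (Set.ext fun x => ?_)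
    change x ∈ (D : Set (Path A)) ∩ D' ↔ _
    rw [Set.mem_inter_iff, hD, hD', hD'']
    simp [followers, coeff_ne_zero_iff hA01]

/-- A family that satisfies the relations of the Exel–Laca algebra, together with the projections
that correspond to sets of paths, satisfies the relations of the subshift C⋆-algebra. -/
theorem IsFamily.lift_setProj_eq_of_rel {B : Type*} [CStarAlgebra B] {S : I → B}
    (hA01 : ∀ i j, A i j = 0 ∨ A i j = 1)
    (hrow : ∀ i, ∃ j, A i j ≠ 0) (hS : IsFamily A S)
    {a b : FreeStarAlg (I ⊕ (markovSubshift A).U)} (h : (markovSubshift A).Rel a b) :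
    lift (Sum.elim S (setProj hA01 hS)) a = lift (Sum.elim S (setProj hA01 hS)) b := by
  have hs : ∀ i, lift (Sum.elim S (setProj hA01 hS)) ((markovSubshift A).s i) = S i :=
    fun i => lift_gen _ _
  have hp : ∀ E, lift (Sum.elim S (setProj hA01 hS)) ((markovSubshift A).p E) =
      setProj hA01 hS E := fun i => lift_gen _ _
  have hinf : ∀ E F, setProj hA01 hS (E ⊓ F) = setProj hA01 hS E * setProj hA01 hS F := by
    intro E F
    obtain ⟨n, h⟩ := exists_graph_setProj hA01 hS E
    obtain ⟨m, h'⟩ := exists_graph_setProj hA01 hS F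
    exact setProj_eq hA01 hrow hS
      ((h.mono (le_max_left n m)).inter (h'.mono (le_max_right n m)))
  cases h with
  | s_partialIsometry i => simpa [hs, map_star] using hS.partialIsometry i
  | p_idem E =>
    rw [map_mul, hp]
    exact (exists_graph_setProj hA01 hS E).choose_spec.idem hS
  | p_star E =>
    rw [map_star, hp]
    exact (exists_graph_setProj hA01 hS E).choose_spec.star_eq hS
  | p_univ =>
    rw [hp, map_one]
    exact setProj_eq hA01 hrow hS (.univ 0)
  | p_inter E F => rw [map_mul, hp, hp, hp, hinf]
  | p_union E F =>
    rw [map_sub, map_add, hp, hp, hp, hp, hinf]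
    obtain ⟨n, h⟩ := exists_graph_setProj hA01 hS E
    obtain ⟨m, h'⟩ := exists_graph_setProj hA01 hS F
    have := ((h.mono (le_max_left n m)).compl.inter (h'.mono (le_max_right n m)).compl).compl
    rw [← Set.compl_union, compl_compl] at this
    rw [setProj_eq hA01 hrow hS (E := E ⊔ F) this]
    noncomm_ring
  | p_empty =>
    rw [hp, map_zero]
    exact setProj_eq hA01 hrow hS (.empty 0)
  | s_word α β hα hβ =>
    obtain ⟨n, h⟩ := Graph.exists_C hA01 hS α β
    rw [hp, setProj_eq hA01 hrow hS h]
    simp [sWord, map_star, map_list_prod, Function.comp_def, hs]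

end ExelLaca

/-! ### The two homomorphisms and their composites. -/

open ExelLaca Subshift CStarPresentation in
theorem mainTheorem12 {I : Type*} (A : Matrix I I ℤ)
    (hA01 : ∀ i j, A i j = 0 ∨ A i j = 1)
    (hrow : ∀ i, ∃ j, A i j ≠ 0) :
    Nonempty (ExelLaca.UnitalCStarAlg A ≃⋆ₐ[ℂ] (ExelLaca.markovSubshift A).UnitalCStarAlg) := by
  let Φ : ExelLaca.UnitalCStarAlg A →⋆ₐ[ℂ] (markovSubshift A).UnitalCStarAlg :=
    liftHom (markovSubshift A).iso fun _ _ h => (isFamily_iso hA01 hrow).lift_eq_of_rel h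
  have hΦ : ∀ i, Φ ((ExelLaca.presentation A).ofHom (S i)) = (markovSubshift A).iso i :=
    liftHom_gen _ _
  let Ψ : (markovSubshift A).UnitalCStarAlg →⋆ₐ[ℂ] ExelLaca.UnitalCStarAlg A :=
    liftHom (Sum.elim _ (setProj hA01 isFamily_ofHom)) fun _ _ h =>
      isFamily_ofHom.lift_setProj_eq_of_rel hA01 hrow h
  have hΨs : ∀ i, Ψ ((markovSubshift A).iso i) = (ExelLaca.presentation A).ofHom (S i) :=
    fun i => liftHom_gen _ _ (Sum.inl i)
  have hΨΦ : Ψ.comp Φ = StarAlgHom.id ℂ _ := hom_ext fun i => by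
    change Ψ (Φ ((ExelLaca.presentation A).ofHom (S i))) = _
    rw [hΦ, hΨs]
    rfl
  -- The sets whose projection is fixed by `Φ ∘ Ψ` are closed under Boolean operations, and include
  -- each `C(α, β)` because relation (ii) writes its projection as a word in the `s_i` and their
  -- adjoints.
  have hproj : ∀ (E : Set (Path A)) (hE : E ∈ (markovSubshift A).U),
      Φ (Ψ ((markovSubshift A).proj ⟨E, hE⟩)) = (markovSubshift A).proj ⟨E, hE⟩ := by
    intro E hE
    induction hE using BooleanSubalgebra.closure_bot_sup_induction with
    | mem E h =>
      obtain ⟨α, hα, β, hβ, rfl⟩ := h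
      have := proj_C hα hβ
      rw [this]
      simp only [map_mul, map_star, map_list_prod, List.map_map, Function.comp_def, hΨs, hΦ]
    | bot =>
      have : (markovSubshift A).proj ⟨⊥, _⟩ = 0 := proj_bot
      rw [this, map_zero, map_zero]
    | sup E hE F hF ih ih' =>
      have h := proj_sup (X := markovSubshift A) ⟨E, hE⟩ ⟨F, hF⟩
      rw [proj_inf] at h
      change (markovSubshift A).proj ⟨E ⊔ F, _⟩ = _ at h
      rw [h]
      simp only [map_sub, map_add, map_mul, ih, ih']
    | compl E hE ih =>
      have h := proj_compl (X := markovSubshift A) ⟨E, hE⟩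
      change (markovSubshift A).proj ⟨Eᶜ, _⟩ = _ at h
      rw [h, map_sub, map_sub, map_one, map_one, ih]
  have hΦΨ : Φ.comp Ψ = StarAlgHom.id ℂ _ := hom_ext fun g => by
    rcases g with i | E
    · change Φ (Ψ ((markovSubshift A).iso i)) = _
      rw [hΨs, hΦ]
      rfl
    · exact hproj E.1 E.2
  exact ⟨StarAlgEquiv.ofStarAlgHom Φ Ψ hΨΦ hΦΨ⟩
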